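/- Let $\mathbb Z_0=\mathbb Z\setminus\{0,1\}$, let $\delta\in[0,\pi/2)$, and let $(q_n)_{n\in\mathbb Z_0}$ be real numbers such that $q_n\ge c>0$ for all $n\in\mathbb Z_0$ and $q_n\to\infty$ as $|n|\to\infty$. Put $\rho_n=e^{2i\delta}$ for $n\le-1$ and $\rho_n=e^{-2i\delta}$ for $n\ge2$, and $\Delta y_n=y_{n+1}-y_n$. Consider the problem $$-\Delta^2y_{n-1}+q_ny_n=\lambda\rho_ny_n\quad(n\in\mathbb Z_0),\qquad y_{-1}=y_1,\quad \Delta y_{-1}=e^{2i\delta}\Delta y_1 .$$ Let $l_0^2$ be the Hilbert space of complex sequences $(y_n)_{n\in\mathbb Z_0}$ with $\sum_{n\in\mathbb Z_0}|y_n|^2<\infty$. Let $D$ be the set of $y\in l_0^2$ with $(q_ny_n)\in l_0^2$, let $L:D\to l_0^2$ be given by $(Ly)_n=-\Delta^2y_{n-1}+q_ny_n$, where $y_0$ and $y_1$ are determined by the conditions $y_{-1}=y_1$, $\Delta y_{-1}=e^{2i\delta}\Delta y_1$, and let $M:l_0^2\to l_0^2$ be the unitary operator $(My)_n=\rho_ny_n$.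 Let $A=M^{-1}L$ with domain $D$. Then $L$ and $A$ are invertible, with bounded inverses defined on all of $l_0^2$, and $A^{-1}=L^{-1}M$ is a completely continuous (compact) operator. Moreover the spectrum of the problem above, that is, the spectrum of $A$ (the set of $\lambda\in\mathbb C$ for which $A-\lambda I$ has no bounded inverse defined on the whole of $l_0^2$), is discrete: it is an at most countable set of eigenvalues of $A$ with no finite accumulation point. -/

import Mathlib

open Filter Topology

noncomputable section

namespace DiscreteNonHermitian

/-- The index set `ℤ ∖ {0, 1}`. -/
abbrev Z0 : Type := {n : ℤ // n ≠ 0 ∧ n ≠ 1}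

/-- The Hilbert space of square-summable complex sequences indexed by `ℤ ∖ {0, 1}`. -/
abbrev l20 : Type := lp (fun _ : Z0 => ℂ) 2

/-- `e^{2iδ}`. -/
def phase (δ : ℝ) : ℂ := Complex.exp (2 * Complex.I * δ)

/-- `ρ_n = e^{2iδ}` for `n ≤ -1` and `ρ_n = e^{-2iδ}` for `n ≥ 2`. -/
def rho (δ : ℝ) (n : Z0) : ℂ :=
  if (n : ℤ) ≤ -1 then Complex.exp (2 * Complex.I * δ) else Complex.exp (-(2 * Complex.I * δ))

/-- The extension to all of `ℤ` of a sequence on `ℤ ∖ {0, 1}` by the values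
`y_1 = y_{-1}` and `y_0 = y_{-1} + e^{2iδ} (y_2 - y_1)`, which are the only ones for which
`y_{-1} = y_1` and `Δ y_{-1} = e^{2iδ} Δ y_1` (see `extend_unique`). -/
def extend (δ : ℝ) (y : Z0 → ℂ) (n : ℤ) : ℂ :=
  if h : n ≠ 0 ∧ n ≠ 1 then y ⟨n, h⟩
  else if n = 0 then
    y ⟨-1, by decide⟩ + phase δ * (y ⟨2, by decide⟩ - y ⟨-1, by decide⟩)
  else y ⟨-1, by decide⟩

/-- The extension is characterised by agreeing with `y` on `ℤ ∖ {0, 1}` and satisfying the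
transition conditions. -/
theorem extend_unique (δ : ℝ) (y : Z0 → ℂ) (Y : ℤ → ℂ) :
    ((∀ n : Z0, Y n = y n) ∧ Y (-1) = Y 1 ∧
        fwdDiff 1 Y (-1) = Complex.exp (2 * Complex.I * δ) * fwdDiff 1 Y 1) ↔
      Y = extend δ y := by
  constructor
  · rintro ⟨h, h1, h2⟩
    have hm : Y (-1) = y ⟨-1, by decide⟩ := h ⟨-1, by decide⟩
    have h2' : Y 2 = y ⟨2, by decide⟩ := h ⟨2, by decide⟩
    funext n
    by_cases hn : n ≠ 0 ∧ n ≠ 1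
    · simp only [extend, hn, dif_pos, ne_eq, not_false_eq_true, and_self]
      exact h ⟨n, hn⟩
    · by_cases h0 : n = 0
      · subst h0
        simp only [fwdDiff, Int.reduceNeg, neg_add_cancel, one_add_one_eq_two] at h2
        rw [← h1, h2', hm] at h2
        simp only [extend, phase, ne_eq, not_true_eq_false, false_and, dif_neg,
          not_false_eq_true, if_true]
        linear_combination h2
      · have h1' : n = 1 := by by_contra h3; exact hn ⟨h0, h3⟩
        subst h1'
        simp [extend, ← h1, hm]
  · rintro rfl
    refine ⟨fun n => ?_, ?_, ?_⟩
    · simp only [extend]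
      rw [dif_pos n.2]
    · simp [extend]
    · simp [extend, fwdDiff, phase]

theorem extend_add (δ : ℝ) (y z : Z0 → ℂ) (n : ℤ) :
    extend δ (y + z) n = extend δ y n + extend δ z n := by
  unfold extend
  split_ifs <;> simp only [Pi.add_apply]
  ring

theorem extend_smul (δ : ℝ) (a : ℂ) (y : Z0 → ℂ) (n : ℤ) :
    extend δ (a • y) n = a * extend δ y n := by
  unfold extend
  split_ifs <;> simp only [Pi.smul_apply, smul_eq_mul]
  ring

theorem memℓp_two_iff {ι : Type*} (f : ι → ℂ) : Memℓp f 2 ↔ Summable fun i => ‖f i‖ ^ 2 := by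
  rw [memℓp_gen_iff (by norm_num)]
  simp

theorem extend_memℓp (δ : ℝ) {y : Z0 → ℂ} (hy : Memℓp y 2) : Memℓp (extend δ y) 2 := by
  rw [memℓp_two_iff] at hy ⊢
  have hs : ({n : ℤ | n ≠ 0 ∧ n ≠ 1}ᶜ : Set ℤ).Finite :=
    (Set.toFinite ({0, 1} : Set ℤ)).subset (by
      intro n hn
      simp only [Set.mem_compl_iff, Set.mem_ofPred_eq] at hn
      simp only [Set.mem_insert_iff, Set.mem_singleton_iff]
      tauto)
  refine (Set.Finite.summable_compl_iff
    (s := {n : ℤ | n ≠ 0 ∧ n ≠ 1}ᶜ) hs).1 ?_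
  rw [compl_compl]
  refine hy.congr fun n => ?_
  have h : extend δ y n.1 = y n := by
    unfold extend
    rw [dif_pos n.2]
  exact congrArg (fun z : ℂ => ‖z‖ ^ 2) h.symm

theorem memℓp_extend_shift (δ : ℝ) {y : Z0 → ℂ} (hy : Memℓp y 2) (k : ℤ) :
    Memℓp (fun n : Z0 => extend δ y (n + k)) 2 := by
  have h := extend_memℓp δ hy
  rw [memℓp_two_iff] at h ⊢
  exact h.comp_injective (i := fun n : Z0 => (n : ℤ) + k)
    ((add_left_injective k).comp Subtype.val_injective)

/-- The sequence `-Δ² y_{n-1} + q_n y_n`, `n ∈ ℤ ∖ {0, 1}`, where `y_0` and `y_1` are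
determined by the transition conditions. -/
def diffExpr (δ : ℝ) (q : Z0 → ℝ) (y : Z0 → ℂ) (n : Z0) : ℂ :=
  -(fwdDiff 1 (fwdDiff 1 (extend δ y)) ((n : ℤ) - 1)) + (q n : ℂ) * y n

theorem diffExpr_eq (δ : ℝ) (q : Z0 → ℝ) (y : Z0 → ℂ) (n : Z0) :
    diffExpr δ q y n =
      -(extend δ y (n + 1) - 2 * extend δ y (n + 0) + extend δ y (n + -1)) + (q n : ℂ) * y n := by
  simp only [diffExpr, fwdDiff]
  rw [show (n : ℤ) - 1 + 1 = n + 0 by ring, show (n : ℤ) + 0 + 1 = n + 1 by ring,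
    show (n : ℤ) - 1 = n + -1 by ring]
  ring

theorem diffExpr_memℓp (δ : ℝ) (q : Z0 → ℝ) {y : Z0 → ℂ} (hy : Memℓp y 2)
    (hqy : Memℓp (fun n => (q n : ℂ) * y n) 2) : Memℓp (diffExpr δ q y) 2 := by
  have h := ((((memℓp_extend_shift δ hy 1).sub
    ((memℓp_extend_shift δ hy 0).const_mul 2)).add (memℓp_extend_shift δ hy (-1))).neg).add hqy
  convert h using 1
  funext n
  rw [diffExpr_eq]
  rfl

/-- The domain `D` of all `y ∈ l²` with `(q_n y_n) ∈ l²`. -/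
def domL (q : Z0 → ℝ) : Submodule ℂ l20 where
  carrier := {y | Memℓp (fun n => (q n : ℂ) * y n) 2}
  zero_mem' := by
    have h : (fun n : Z0 => (q n : ℂ) * (0 : l20) n) = 0 := by
      funext n
      simp
    simpa only [Set.mem_ofPred_eq, h] using zero_memℓp
  add_mem' := by
    intro y z hy hz
    have h := Memℓp.add hy hz
    refine (congrArg (fun f => Memℓp f 2) ?_).mp h
    funext n
    simp [mul_add]
  smul_mem' := by
    intro a y hy
    have h := Memℓp.const_mul hy a
    refine (congrArg (fun f => Memℓp f 2) ?_).mp h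
    funext n
    simp [mul_left_comm]

/-- The operator `L` with domain `D`: `(L y)_n = -Δ² y_{n-1} + q_n y_n`, where `y_0` and `y_1`
are defined by the transition conditions. -/
def opL (δ : ℝ) (q : Z0 → ℝ) : l20 →ₗ.[ℂ] l20 where
  domain := domL q
  toFun :=
    { toFun := fun y => ⟨diffExpr δ q (y : l20), diffExpr_memℓp δ q (lp.memℓp (y : l20)) y.2⟩
      map_add' := by
        intro y z
        refine lp.ext ?_
        funext n
        change diffExpr δ q ((y : l20) + (z : l20) : l20) n =
          diffExpr δ q (y : l20) n + diffExpr δ q (z : l20) n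
        rw [diffExpr_eq, diffExpr_eq, diffExpr_eq, lp.coeFn_add, extend_add, extend_add,
          extend_add, Pi.add_apply]
        ring
      map_smul' := by
        intro a y
        refine lp.ext ?_
        funext n
        change diffExpr δ q (a • (y : l20) : l20) n = a * diffExpr δ q (y : l20) n
        rw [diffExpr_eq, diffExpr_eq, lp.coeFn_smul, extend_smul, extend_smul, extend_smul,
          Pi.smul_apply, smul_eq_mul]
        ring }

theorem norm_rho (δ : ℝ) (n : Z0) : ‖rho δ n‖ = 1 := by
  unfold rho
  split_ifs <;> simp [Complex.norm_exp]

theorem memℓp_of_norm_eq {y z : Z0 → ℂ} (hy : Memℓp y 2) (h : ∀ n, ‖z n‖ = ‖y n‖) :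
    Memℓp z 2 := by
  rw [memℓp_two_iff] at hy ⊢
  simpa only [h] using hy

/-- The unitary operator `(M y)_n = ρ_n y_n`; its inverse is multiplication by `ρ_n⁻¹`. -/
def opM (δ : ℝ) : l20 ≃ₗᵢ[ℂ] l20 where
  toFun y := ⟨fun n => rho δ n * y n,
    memℓp_of_norm_eq (lp.memℓp y) fun n => by rw [norm_mul, norm_rho, one_mul]⟩
  invFun y := ⟨fun n => (rho δ n)⁻¹ * y n,
    memℓp_of_norm_eq (lp.memℓp y) fun n => by rw [norm_mul, norm_inv, norm_rho, inv_one, one_mul]⟩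
  map_add' y z := by
    refine lp.ext (funext fun n => ?_)
    exact mul_add (rho δ n) (y n) (z n)
  map_smul' a y := by
    refine lp.ext (funext fun n => ?_)
    exact mul_left_comm (rho δ n) a (y n)
  left_inv y := by
    refine lp.ext (funext fun n => ?_)
    have h : rho δ n ≠ 0 := norm_ne_zero_iff.1 (by rw [norm_rho]; exact one_ne_zero)
    exact inv_mul_cancel_left₀ h (y n)
  right_inv y := by
    refine lp.ext (funext fun n => ?_)
    have h : rho δ n ≠ 0 := norm_ne_zero_iff.1 (by rw [norm_rho]; exact one_ne_zero)
    exact mul_inv_cancel_left₀ h (y n)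
  norm_map' y := by
    rw [lp.norm_eq_tsum_rpow (by norm_num), lp.norm_eq_tsum_rpow (by norm_num)]
    congr 1
    refine tsum_congr fun n => ?_
    congr 1
    change ‖rho δ n * y n‖ = ‖y n‖
    rw [norm_mul, norm_rho, one_mul]

/-- The operator `A = M⁻¹ L` with domain `D`. -/
def opA (δ : ℝ) (q : Z0 → ℝ) : l20 →ₗ.[ℂ] l20 :=
  ((opM δ).symm.toLinearEquiv : l20 →ₗ[ℂ] l20).compPMap (opL δ q)

section General

variable {E : Type*} [NormedAddCommGroup E] [NormedSpace ℂ E]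

/-- `B` is a bounded operator, defined on the whole space, which is the two-sided inverse of
the (not necessarily bounded or everywhere defined) operator `T`. -/
def IsBoundedInverse (T : E →ₗ.[ℂ] E) (B : E →L[ℂ] E) : Prop :=
  (∀ x : T.domain, B (T x) = x) ∧ ∀ y : E, ∃ h : B y ∈ T.domain, T ⟨B y, h⟩ = y

/-- The operator `T - μ I`, with the same domain as `T`. -/
def shift (T : E →ₗ.[ℂ] E) (μ : ℂ) : E →ₗ.[ℂ] E where
  domain := T.domain
  toFun := T.toFun - μ • T.domain.subtype

/-- `μ` is a regular point of `T`: the inverse of `T - μ I` exists and is a bounded operator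
defined on the whole space. -/
def IsRegularPoint (T : E →ₗ.[ℂ] E) (μ : ℂ) : Prop :=
  ∃ B : E →L[ℂ] E, IsBoundedInverse (shift T μ) B

/-- The spectrum of `T`: the set of all complex numbers that are not regular points of `T`. -/
def operatorSpectrum (T : E →ₗ.[ℂ] E) : Set ℂ := {μ | ¬ IsRegularPoint T μ}

/-- `μ` is an eigenvalue of `T`. -/
def IsEigenvalue (T : E →ₗ.[ℂ] E) (μ : ℂ) : Prop :=
  ∃ x : T.domain, (x : E) ≠ 0 ∧ T x = μ • (x : E)

/-- The spectrum of `T` is discrete: it is an at most countable set of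
eigenvalues of `T` with no finite point of accumulation. -/
def HasDiscreteSpectrum (T : E →ₗ.[ℂ] E) : Prop :=
  (∀ μ ∈ operatorSpectrum T, IsEigenvalue T μ) ∧ (operatorSpectrum T).Countable ∧
    ∀ z : ℂ, ¬ AccPt z (𝓟 (operatorSpectrum T))

end General

end DiscreteNonHermitian

end

open DiscreteNonHermitian

/-! Dividing by `q` turns `L y = f` into `(1 + S) y = K f`, where `K` is multiplication by `1 / q`
and `S = K T` with `T = -Δ²` bounded. Since `1 / q → 0`, both `K` and `S` are compact, so by the
Fredholm alternative `1 + S` is invertible once `L` has trivial kernel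
(`exists_isBoundedInverse_opL`). Then `L⁻¹ = (1 + S)⁻¹ K` is compact, and so is `A⁻¹ = L⁻¹ M`.

The kernel is trivial by an energy identity on each half-line (`eq_zero_of_diffExpr_eq_zero`): the
boundary terms at `1` and `-1` are real of opposite signs, yet differ by the factor `e^{2iδ}`, which
is not `-1`. So they vanish, and the energies with them.

Discreteness is the Riesz theory of compact operators, applied to `A⁻¹`
(`hasDiscreteSpectrum_of_isCompactOperator`). -/

namespace DiscreteNonHermitian

/-! ### Spectrum of an operator with compact inverse -/

section CompactInverse

variable {E : Type*} [NormedAddCommGroup E] [NormedSpace ℂ E]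

/-- A compact operator does not have infinitely many eigenvalues `1 / μ` with bounded `μ`. -/
theorem not_injective_of_hasEigenvector {K : E →L[ℂ] E} (hK : IsCompactOperator K) {R : ℝ}
    {μ : ℕ → ℂ} (hR : ∀ n, ‖μ n‖ ≤ R) (hμ0 : ∀ n, μ n ≠ 0) {x : ℕ → E} (hx0 : ∀ n, x n ≠ 0)
    (hx : ∀ n, μ n • K (x n) = x n) : ¬ Function.Injective μ := by
  intro hμ
  have hli : LinearIndependent ℂ x := by
    refine Module.End.eigenvectors_linearIndependent' (K : E →ₗ[ℂ] E) (fun n => (μ n)⁻¹)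
      (inv_injective.comp hμ) x fun n => ?_
    refine Module.End.hasEigenvector_iff.2 ⟨Module.End.mem_eigenspace_iff.2 ?_, hx0 n⟩
    change K (x n) = (μ n)⁻¹ • x n
    rw [eq_inv_smul_iff₀ (hμ0 n), hx n]
  let V : ℕ → Submodule ℂ E := fun n => Submodule.span ℂ (x '' Set.Iio n)
  have hVmono : Monotone V := fun m n hmn =>
    Submodule.span_mono (Set.image_mono (Set.Iio_subset_Iio hmn))
  have hVmem : ∀ {m n}, m < n → x m ∈ V n := fun {m n} hmn =>
    Submodule.subset_span ⟨m, hmn, rfl⟩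
  have hVnot : ∀ n, x n ∉ V n := fun n => hli.notMem_span_image (by simp)
  have hVK : ∀ n, ∀ u ∈ V n, K u ∈ V n := by
    intro n
    have h : V n ≤ (V n).comap (K : E →ₗ[ℂ] E) := by
      refine Submodule.span_le.2 ?_
      rintro _ ⟨m, hm, rfl⟩
      have h1 : K (x m) = (μ m)⁻¹ • x m := by rw [eq_inv_smul_iff₀ (hμ0 m), hx m]
      change K (x m) ∈ V n
      rw [h1]
      exact (V n).smul_mem _ (hVmem hm)
    exact h
  have hVshift : ∀ n, ∀ u ∈ V (n + 1), u - K (μ n • u) ∈ V n := by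
    intro n
    have h : V (n + 1) ≤ (V n).comap (LinearMap.id - μ n • (K : E →ₗ[ℂ] E)) := by
      refine Submodule.span_le.2 ?_
      rintro _ ⟨m, hm, rfl⟩
      change x m - μ n • K (x m) ∈ V n
      rcases (Nat.lt_succ_iff.1 hm).lt_or_eq with h | rfl
      · exact (V n).sub_mem (hVmem h) ((V n).smul_mem _ (hVK n _ (hVmem h)))
      · rw [hx, sub_self]
        exact zero_mem _
    intro u hu
    rw [map_smul]
    exact h hu
  -- Riesz's lemma gives almost orthogonal vectors along the flag `V`; the bound 3 is any number
  -- above the norm of the scalar 2.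
  have hex : ∀ n, ∃ u ∈ V (n + 1), ‖u‖ ≤ 3 ∧ ∀ y ∈ V n, 1 ≤ ‖u - y‖ := by
    intro n
    have hfin : FiniteDimensional ℂ (V n) :=
      FiniteDimensional.span_of_finite ℂ ((Set.finite_Iio n).image x)
    have hcl : IsClosed (((V n).comap (V (n + 1)).subtype : Submodule ℂ (V (n + 1))) :
        Set (V (n + 1))) :=
      (Submodule.closed_of_finiteDimensional (V n)).preimage continuous_subtype_val
    obtain ⟨u, hu, h⟩ := riesz_lemma_of_norm_lt (c := (2 : ℂ)) (R := 3) (by norm_num)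
      (by norm_num) hcl ⟨⟨x n, hVmem n.lt_succ_self⟩, hVnot n⟩
    refine ⟨u, u.2, hu, fun y hy => ?_⟩
    exact h ⟨y, hVmono n.le_succ hy⟩ hy
  choose u huV hu3 hu using hex
  -- `K (μ n • u n)` equals `u n` modulo `V n`, and `K (μ m • u m)` lies in `V n`. The images are
  -- thus 1-separated, while `μ n • u n` stays bounded: this contradicts compactness.
  have hsep : ∀ m n, m < n → 1 ≤ ‖K (μ n • u n) - K (μ m • u m)‖ := by
    intro m n hmn
    have hm : K (μ m • u m) ∈ V n :=
      hVK n _ ((V n).smul_mem _ (hVmono (Nat.succ_le_of_lt hmn) (huV m)))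
    have h := hu n _ ((V n).add_mem (hVshift n _ (huV n)) hm)
    rwa [show u n - (u n - K (μ n • u n) + K (μ m • u m)) =
      K (μ n • u n) - K (μ m • u m) by abel] at h
  have hb : ∀ n, μ n • u n ∈ Metric.closedBall (0 : E) (R * 3) := by
    intro n
    rw [mem_closedBall_zero_iff, norm_smul]
    exact mul_le_mul (hR n) (hu3 n) (norm_nonneg _) ((norm_nonneg _).trans (hR n))
  obtain ⟨C, hC, hKC⟩ := IsCompactOperator.image_closedBall_subset_compact
    (f := (K : E →ₗ[ℂ] E)) hK (R * 3)
  obtain ⟨a, -, φ, hφ, ha⟩ := hC.tendsto_subseq (x := fun n => K (μ n • u n))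
    fun n => hKC ⟨_, hb n, rfl⟩
  obtain ⟨N, hN⟩ := Metric.cauchySeq_iff.1 ha.cauchySeq 1 one_pos
  have h := hN (N + 1) N.le_succ N le_rfl
  rw [dist_eq_norm] at h
  exact absurd (hsep _ _ (hφ N.lt_succ_self)) (not_le.2 h)

variable {T : E →ₗ.[ℂ] E} {K : E →L[ℂ] E}

/-- On the domain, `K (T - μ) = 1 - μ K`, so the resolvent has to be `(1 - μ K)⁻¹ K`. -/
theorem isRegularPoint_of_isUnit (hT : IsBoundedInverse T K) {μ : ℂ}
    (h : IsUnit (1 - μ • K)) : IsRegularPoint T μ := by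
  obtain ⟨u, hu⟩ := h
  have hl : ∀ x, (↑u⁻¹ : E →L[ℂ] E) (x - μ • K x) = x := fun x => by
    have := congrArg (fun f : E →L[ℂ] E => f x) u.inv_mul
    rw [hu] at this
    simpa using this
  have hr : ∀ x, (↑u⁻¹ : E →L[ℂ] E) x - μ • K ((↑u⁻¹ : E →L[ℂ] E) x) = x := fun x => by
    have := congrArg (fun f : E →L[ℂ] E => f x) u.mul_inv
    rw [hu] at this
    simpa using this
  refine ⟨(↑u⁻¹ : E →L[ℂ] E) ∘L K, fun x => ?_, fun y => ?_⟩
  · change (↑u⁻¹ : E →L[ℂ] E) (K (T x - μ • (x : E))) = x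
    rw [map_sub, map_smul, hT.1 x, hl]
  · set z : E := (↑u⁻¹ : E →L[ℂ] E) (K y) with hz
    have h1 : K (y + μ • z) = z := by
      rw [map_add, map_smul, ← eq_sub_iff_add_eq]
      exact (hr (K y)).symm
    obtain ⟨h2, h3⟩ := hT.2 (y + μ • z)
    have h4 : z ∈ T.domain := by rwa [h1] at h2
    refine ⟨h4, ?_⟩
    have h5 : T ⟨z, h4⟩ = y + μ • z := by
      rw [← h3]
      exact congrArg T (Subtype.ext h1.symm)
    change T ⟨z, h4⟩ - μ • z = y
    rw [h5, add_sub_cancel_right]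

variable [CompleteSpace E]

/-- Fredholm alternative for `K` at `μ⁻¹`, using `1 - μ K = μ (μ⁻¹ - K)`. -/
theorem exists_ne_zero_of_not_isRegularPoint (hT : IsBoundedInverse T K)
    (hK : IsCompactOperator K) {μ : ℂ} (h : ¬ IsRegularPoint T μ) :
    μ ≠ 0 ∧ ∃ x, x ≠ 0 ∧ μ • K x = x := by
  have hu := mt (isRegularPoint_of_isUnit hT) h
  have hμ : μ ≠ 0 := by
    rintro rfl
    exact hu (by simp)
  refine ⟨hμ, ?_⟩
  rcases hK.hasEigenvalue_or_mem_resolventSet (inv_ne_zero hμ) with he | hr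
  · obtain ⟨x, hx⟩ := he.exists_hasEigenvector
    refine ⟨x, hx.2, ?_⟩
    have h1 : K x = μ⁻¹ • x := hx.apply_eq_smul
    rw [h1, smul_inv_smul₀ hμ]
  · refine absurd ?_ hu
    rw [spectrum.mem_resolventSet_iff] at hr
    have h2 : (1 - μ • K) = (Units.mk0 μ hμ) • (algebraMap ℂ (E →L[ℂ] E) μ⁻¹ - K) := by
      rw [Units.smul_mk0, smul_sub, Algebra.algebraMap_eq_smul_one, smul_inv_smul₀ hμ]
    rw [h2]
    exact hr.smul _

/-- An operator with compact inverse has discrete spectrum. -/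
theorem hasDiscreteSpectrum_of_isCompactOperator (hT : IsBoundedInverse T K)
    (hK : IsCompactOperator K) : HasDiscreteSpectrum T := by
  have hacc : ∀ z : ℂ, ¬ AccPt z (𝓟 (operatorSpectrum T)) := by
    intro z hz
    have hinf := Set.Infinite.of_accPt (hz.nhds_inter (Metric.ball_mem_nhds z one_pos))
    let μ := hinf.natEmbedding
    have hμ : ∀ n, ((μ n : ℂ) ≠ 0 ∧ ∃ x, x ≠ 0 ∧ (μ n : ℂ) • K x = x) := fun n =>
      exists_ne_zero_of_not_isRegularPoint hT hK (μ n).2.2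
    choose hμ0 x hx0 hx using hμ
    refine not_injective_of_hasEigenvector hK (R := ‖z‖ + 1) (fun n => ?_) hμ0 hx0 hx
      (Subtype.val_injective.comp μ.injective)
    have h1 : dist (μ n : ℂ) z < 1 := (μ n).2.1
    rw [dist_eq_norm] at h1
    have h2 := norm_sub_norm_le (μ n : ℂ) z
    linarith
  refine ⟨fun μ hμ => ?_, ?_, hacc⟩
  · obtain ⟨-, x, hx0, hx⟩ := exists_ne_zero_of_not_isRegularPoint hT hK hμ
    obtain ⟨h1, h2⟩ := hT.2 (μ • x)
    have h3 : K (μ • x) = x := by rw [map_smul, hx]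
    exact ⟨⟨K (μ • x), h1⟩, by simpa only [h3] using hx0, by rw [h2]; exact congrArg _ h3.symm⟩
  -- A discrete subspace of the second countable space `ℂ` is countable.
  · have := discreteTopology_of_noAccPts fun x (_ : x ∈ operatorSpectrum T) => hacc x
    exact Set.countable_coe_iff.mp
      (TopologicalSpace.separableSpace_iff_countable.mp inferInstance)

end CompactInverse

end DiscreteNonHermitian

namespace DiscreteNonHermitian

/-! ### Diagonal operators -/

section Diagonal

variable {ι : Type*}

theorem norm_mul_le_of_bound {a : ι → ℂ} {C : ℝ} (ha : ∀ n, ‖a n‖ ≤ C) (z : ι → ℂ) (n : ι) :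
    ‖a n * z n‖ ≤ ‖(C : ℂ) * z n‖ := by
  rw [norm_mul, norm_mul, Complex.norm_real]
  exact mul_le_mul_of_nonneg_right ((ha n).trans (Real.le_norm_self C)) (norm_nonneg _)

theorem memℓp_mul_of_bound {a : ι → ℂ} {C : ℝ} (ha : ∀ n, ‖a n‖ ≤ C) {y : ι → ℂ}
    (hy : Memℓp y 2) : Memℓp (fun n => a n * y n) 2 := by
  have h := hy.const_mul (C : ℂ)
  rw [memℓp_two_iff] at h ⊢
  exact h.of_nonneg_of_le (fun n => by positivity) fun n =>
    pow_le_pow_left₀ (norm_nonneg _) (norm_mul_le_of_bound ha y n) 2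

/-- Multiplication by a bounded sequence. -/
noncomputable def diagonal (a : ι → ℂ) (C : ℝ) (ha : ∀ n, ‖a n‖ ≤ C) :
    lp (fun _ : ι => ℂ) 2 →L[ℂ] lp (fun _ : ι => ℂ) 2 :=
  LinearMap.mkContinuous
    { toFun := fun y => ⟨fun n => a n * y n, memℓp_mul_of_bound ha (lp.memℓp y)⟩
      map_add' := fun y z => lp.ext (funext fun n => mul_add (a n) (y n) (z n))
      map_smul' := fun c y => lp.ext (funext fun n => mul_left_comm (a n) c (y n)) }
    |C| fun y => by
      refine (lp.norm_mono (by norm_num) (y := (C : ℂ) • y)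
        (norm_mul_le_of_bound ha y)).trans ?_
      rw [norm_smul, Complex.norm_real, Real.norm_eq_abs]

theorem norm_diagonal_le {a : ι → ℂ} {C : ℝ} (ha : ∀ n, ‖a n‖ ≤ C) : ‖diagonal a C ha‖ ≤ |C| :=
  LinearMap.mkContinuous_norm_le _ (abs_nonneg C) _

/-- Multiplication by a sequence that tends to zero is compact. -/
theorem isCompactOperator_diagonal {a : ι → ℂ} {C : ℝ} (ha : ∀ n, ‖a n‖ ≤ C)
    (h0 : Tendsto a cofinite (𝓝 0)) : IsCompactOperator (diagonal a C ha) := by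
  classical
  -- Finite-rank truncations; what they leave out is diagonal with entries at most `ε / 2` once `s`
  -- contains every index with a larger entry.
  let F : Finset ι → (lp (fun _ : ι => ℂ) 2 →L[ℂ] lp (fun _ : ι => ℂ) 2) := fun s =>
    ∑ i ∈ s, (lp.singleContinuousLinearMap ℂ (fun _ : ι => ℂ) 2 i) ∘L
      (a i • lp.evalCLM ℂ (fun _ : ι => ℂ) 2 i)
  have hF : ∀ s, IsCompactOperator (F s) := by
    intro s
    refine Submodule.sum_mem (compactOperator (RingHom.id ℂ) (lp (fun _ : ι => ℂ) 2)
      (lp (fun _ : ι => ℂ) 2)) fun i _ => ?_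
    have h : IsCompactOperator (a i • lp.evalCLM ℂ (fun _ : ι => ℂ) 2 i) :=
      isCompactOperator_of_locallyCompactSpace_dom (R₂ := ℂ) (M₂ := ℂ)
        (a i • lp.evalCLM ℂ (fun _ : ι => ℂ) 2 i)
    exact h.clm_comp (lp.singleContinuousLinearMap ℂ (fun _ : ι => ℂ) 2 i)
  have hFapp : ∀ s y n, F s y n = if n ∈ s then a n * y n else 0 := by
    intro s y n
    simp only [F, sum_apply, lp.coeFn_sum, Finset.sum_apply,
      ContinuousLinearMap.comp_apply, lp.singleContinuousLinearMap_apply, lp.single_apply,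
      Finset.sum_pi_single]
    rfl
  refine isCompactOperator_of_tendsto (l := atTop) (F := F) ?_ (Eventually.of_forall hF)
  rw [Metric.tendsto_atTop]
  intro ε hε
  have hfin : {n | ¬ ‖a n‖ < ε / 2}.Finite := by
    have := (tendsto_zero_iff_norm_tendsto_zero.1 h0).eventually_lt_const (half_pos hε)
    exact this
  refine ⟨hfin.toFinset, fun s hs => ?_⟩
  have hle : ∀ n, ‖if n ∈ s then 0 else a n‖ ≤ ε / 2 := by
    intro n
    split_ifs with h
    · simpa using (half_pos hε).le
    · by_contra hn
      exact h (hs (hfin.mem_toFinset.2 fun h' => hn h'.le))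
  have heq : diagonal a C ha - F s = diagonal (fun n => if n ∈ s then 0 else a n) (ε / 2) hle := by
    refine ContinuousLinearMap.ext fun y => lp.ext (funext fun n => ?_)
    change a n * y n - F s y n = (if n ∈ s then 0 else a n) * y n
    rw [hFapp]
    split_ifs <;> simp
  rw [dist_comm, dist_eq_norm, heq]
  refine (norm_diagonal_le hle).trans_lt ?_
  rw [abs_of_pos (half_pos hε)]
  exact half_lt_self hε

end Diagonal

/-! ### Boundedness of the second difference -/

theorem tendsto_extend (δ : ℝ) {u : ℕ → l20} {x : l20} (h : Tendsto u atTop (𝓝 x)) (n : ℤ) :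
    Tendsto (fun k => extend δ (u k) n) atTop (𝓝 (extend δ x n)) := by
  have he : ∀ n : Z0, Tendsto (fun k => (u k n : ℂ)) atTop (𝓝 (x n : ℂ)) := fun n =>
    ((lp.evalCLM ℂ (fun _ : Z0 => ℂ) 2 n).continuous.tendsto x).comp h
  unfold extend
  split_ifs
  · exact he _
  · exact (he ⟨-1, by decide⟩).add (Tendsto.const_mul (M := ℂ) _
      (Tendsto.sub (G := ℂ) (he ⟨2, by decide⟩) (he ⟨-1, by decide⟩)))
  · exact he _

theorem memℓp_diffExpr_zero (δ : ℝ) {y : Z0 → ℂ} (hy : Memℓp y 2) :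
    Memℓp (diffExpr δ 0 y) 2 := by
  refine diffExpr_memℓp δ 0 hy ?_
  convert zero_memℓp (E := fun _ : Z0 => ℂ) using 2
  simp

theorem diffExpr_eq_add (δ : ℝ) (q : Z0 → ℝ) (y : Z0 → ℂ) (n : Z0) :
    diffExpr δ q y n = diffExpr δ 0 y n + (q n : ℂ) * y n := by
  simp [diffExpr]

/-- The linear map `(T y)_n = -Δ² y_{n-1}`. -/
noncomputable def secondDiffₗ (δ : ℝ) : l20 →ₗ[ℂ] l20 where
  toFun y := ⟨diffExpr δ 0 y, memℓp_diffExpr_zero δ (lp.memℓp y)⟩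
  map_add' y z := by
    refine lp.ext (funext fun n => ?_)
    change diffExpr δ 0 (y + z : l20) n = diffExpr δ 0 y n + diffExpr δ 0 z n
    simp only [diffExpr_eq, lp.coeFn_add, extend_add, Pi.add_apply]
    ring
  map_smul' a y := by
    refine lp.ext (funext fun n => ?_)
    change diffExpr δ 0 (a • y : l20) n = a * diffExpr δ 0 y n
    simp only [diffExpr_eq, lp.coeFn_smul, extend_smul, Pi.smul_apply, smul_eq_mul]
    ring

/-- By the closed graph theorem coordinatewise limits suffice, and each coordinate of the image
involves only finitely many coordinates of the argument. -/
theorem continuous_secondDiffₗ (δ : ℝ) : Continuous (secondDiffₗ δ) := by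
  refine LinearMap.continuous_of_seq_closed_graph _ fun u x y hu hy => ?_
  refine lp.ext (funext fun n => ?_)
  change y n = diffExpr δ 0 x n
  have h1 : Tendsto (fun k => diffExpr δ 0 (u k) n) atTop (𝓝 (y n)) :=
    ((lp.evalCLM ℂ (fun _ : Z0 => ℂ) 2 n).continuous.tendsto y).comp hy
  refine tendsto_nhds_unique h1 ?_
  simp only [diffExpr_eq, Pi.zero_apply, Complex.ofReal_zero, zero_mul, add_zero]
  exact (((tendsto_extend δ hu _).sub ((tendsto_extend δ hu _).const_mul 2)).add
    (tendsto_extend δ hu _)).neg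

/-- The bounded operator `(T y)_n = -Δ² y_{n-1}`. -/
noncomputable def secondDiff (δ : ℝ) : l20 →L[ℂ] l20 :=
  ⟨secondDiffₗ δ, continuous_secondDiffₗ δ⟩

theorem secondDiff_apply (δ : ℝ) (y : l20) (n : Z0) : secondDiff δ y n = diffExpr δ 0 y n :=
  rfl

end DiscreteNonHermitian

/-! ### Triviality of the kernel -/

namespace DiscreteNonHermitian

/-- A complex sequence with real nonnegative increments that tends to zero starts at a real
nonpositive number, and vanishes identically if it starts at zero. -/
theorem of_increments_nonneg {g : ℕ → ℂ} {d : ℕ → ℝ} (hd : ∀ k, 0 ≤ d k)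
    (hg : ∀ k, g (k + 1) - g k = d k) (h0 : Tendsto g atTop (𝓝 0)) :
    (g 0).im = 0 ∧ (g 0).re ≤ 0 ∧ (g 0 = 0 → ∀ k, d k = 0) := by
  have hre : ∀ k, (g (k + 1)).re = (g k).re + d k := fun k => by
    have := congrArg Complex.re (hg k)
    rw [Complex.sub_re, Complex.ofReal_re] at this
    linarith
  have him : ∀ k, (g k).im = (g 0).im := by
    intro k
    induction k with
    | zero => rfl
    | succ k ih =>
      have := congrArg Complex.im (hg k)
      rw [Complex.sub_im, Complex.ofReal_im] at this
      linarith
  have hmono : Monotone fun k => (g k).re := monotone_nat_of_le_succ fun k => by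
    have := hre k
    have := hd k
    linarith
  have hlim_re : Tendsto (fun k => (g k).re) atTop (𝓝 0) :=
    (Complex.continuous_re.tendsto 0).comp h0
  have hlim_im : Tendsto (fun k => (g k).im) atTop (𝓝 0) :=
    (Complex.continuous_im.tendsto 0).comp h0
  have hle : ∀ k, (g k).re ≤ 0 := fun k => hmono.ge_of_tendsto hlim_re k
  refine ⟨?_, hle 0, fun h k => ?_⟩
  · simp only [him] at hlim_im
    exact tendsto_nhds_unique tendsto_const_nhds hlim_im
  · have h1 : 0 ≤ (g k).re := by
      have := hmono k.zero_le
      simp only [h, Complex.zero_re] at this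
      exact this
    have := hre k
    have := hle (k + 1)
    have := hd k
    linarith

/-- If `z ≠ 0`, then `e^{2iδ} = w / z` is real and nonpositive, hence `-1`, which forces `cos δ =
0`; this is excluded by `δ < π / 2`. -/
theorem eq_zero_of_phase_mul {δ : ℝ} (hδ : δ ∈ Set.Ico 0 (Real.pi / 2)) {z w : ℂ}
    (h : w = phase δ * z) (hz : z.im = 0) (hz' : z.re ≤ 0) (hw : w.im = 0) (hw' : 0 ≤ w.re) :
    z = 0 := by
  have hp : phase δ = Complex.exp ((2 * δ : ℝ) * Complex.I) := by
    unfold phase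
    congr 1
    push_cast
    ring
  have hre : (phase δ).re = Real.cos (2 * δ) := by rw [hp, Complex.exp_ofReal_mul_I_re]
  have him : (phase δ).im = Real.sin (2 * δ) := by rw [hp, Complex.exp_ofReal_mul_I_im]
  have hcos : 0 < Real.cos δ :=
    Real.cos_pos_of_mem_Ioo ⟨by linarith [hδ.1, Real.pi_pos], hδ.2⟩
  rw [h, Complex.mul_im, hz, him, mul_zero, zero_add] at hw
  rw [h, Complex.mul_re, hz, hre, mul_zero, sub_zero] at hw'
  by_contra hne
  have hz0 : z.re ≠ 0 := fun h0 => hne (Complex.ext h0 hz)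
  have hlt : z.re < 0 := lt_of_le_of_ne hz' hz0
  have hs : Real.sin (2 * δ) = 0 := (mul_eq_zero.1 hw).resolve_right hz0
  have hc : Real.cos (2 * δ) ≤ 0 := by
    by_contra hc
    exact absurd hw' (not_le.2 (mul_neg_of_pos_of_neg (not_le.1 hc) hlt))
  have h1 := Real.sin_sq_add_cos_sq (2 * δ)
  rw [hs] at h1
  have h2 := Real.cos_two_mul δ
  have h3 : 0 < Real.cos δ ^ 2 := by positivity
  nlinarith

theorem tendsto_extend_cofinite (δ : ℝ) {y : Z0 → ℂ} (hy : Memℓp y 2) :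
    Tendsto (extend δ y) cofinite (𝓝 0) := by
  have h := (memℓp_two_iff _).1 (extend_memℓp δ hy)
  have h1 := h.tendsto_cofinite_zero.sqrt
  rw [Real.sqrt_zero] at h1
  simp only [Real.sqrt_sq (norm_nonneg _)] at h1
  exact tendsto_zero_iff_norm_tendsto_zero.2 h1

/-- The kernel of the difference operator with the transition conditions is trivial. -/
theorem eq_zero_of_diffExpr_eq_zero {δ : ℝ} (hδ : δ ∈ Set.Ico 0 (Real.pi / 2)) {q : Z0 → ℝ}
    (hq : ∀ n, 0 < q n) {y : Z0 → ℂ} (hy : Memℓp y 2) (h : ∀ n, diffExpr δ q y n = 0) :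
    y = 0 := by
  set Y := extend δ y with hY
  obtain ⟨hYy, hY1, hY2⟩ := (extend_unique δ y Y).2 rfl
  -- The boundary term in summation by parts of the equation against the conjugate of `Y`; `d` is
  -- the energy density.
  let G : ℤ → ℂ := fun n => (Y (n + 1) - Y n) * starRingEnd ℂ (Y n)
  let d : Z0 → ℝ := fun n => ‖Y n - Y (n - 1)‖ ^ 2 + q n * ‖y n‖ ^ 2
  have hd : ∀ n, 0 ≤ d n := fun n => by
    have := (hq n).le
    positivity
  have hG : ∀ n : Z0, G n - G (n - 1) = d n := by
    intro n
    have h1 := h n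
    rw [diffExpr_eq, ← hY, ← hYy n, add_zero, ← sub_eq_add_neg] at h1
    simp only [G, d, sub_add_cancel, ← hYy n]
    push_cast
    rw [← Complex.mul_conj', ← Complex.mul_conj', map_sub]
    linear_combination -(starRingEnd ℂ (Y n)) * h1
  have hlimY := tendsto_extend_cofinite δ hy
  have hlimG : Tendsto G cofinite (𝓝 0) := by
    have h1 : Tendsto (fun n => Y (n + 1)) cofinite (𝓝 0) :=
      hlimY.comp (add_left_injective (1 : ℤ)).tendsto_cofinite
    have h2 := (Complex.continuous_conj.tendsto 0).comp hlimY
    simpa using (h1.sub hlimY).mul h2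
  have hR := of_increments_nonneg (g := fun k : ℕ => G (1 + k))
    (d := fun k => d ⟨k + 2, by omega⟩) (fun k => hd _)
    (fun k => by
      rw [← hG]
      congr 2 <;> push_cast <;> ring)
    (by
      rw [← Nat.cofinite_eq_atTop]
      exact hlimG.comp (Function.Injective.tendsto_cofinite fun a b hab => by
        simpa using hab))
  -- Running towards `-∞` reverses the increments, hence the sign: `G 1 ≤ 0` but `G (-1) ≥ 0`.
  have hL := of_increments_nonneg (g := fun k : ℕ => -G (-1 - k))
    (d := fun k => d ⟨-1 - k, by omega⟩) (fun k => hd _)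
    (fun k => by
      rw [← hG, neg_sub_neg]
      congr 2
      push_cast
      ring)
    (by
      rw [← Nat.cofinite_eq_atTop, ← neg_zero]
      exact (hlimG.comp (Function.Injective.tendsto_cofinite fun a b hab => by
        simpa using hab)).neg)
  simp only [Nat.cast_zero, add_zero, sub_zero, Complex.neg_im, Complex.neg_re, neg_eq_zero,
    Left.neg_nonpos_iff] at hR hL
  have htrans : G (-1) = phase δ * G 1 := by
    simp only [fwdDiff] at hY2
    simp only [G, phase]
    rw [hY2, hY1]
    ring
  have hG1 := eq_zero_of_phase_mul hδ htrans hR.1 hR.2.1 hL.1 hL.2.1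
  have hGm1 : G (-1) = 0 := by rw [htrans, hG1, mul_zero]
  have hd0 : ∀ n, d n = 0 := by
    rintro ⟨n, hn⟩
    rcases le_or_gt 2 n with h2 | h2
    · have := hR.2.2 hG1 (n - 2).toNat
      convert this using 3
      omega
    · have := hL.2.2 hGm1 (-1 - n).toNat
      convert this using 3
      omega
  funext n
  have h1 := hd0 n
  have h2 : q n * ‖y n‖ ^ 2 = 0 := by
    have h3 : 0 ≤ q n * ‖y n‖ ^ 2 := mul_nonneg (hq n).le (by positivity)
    have h4 : 0 ≤ ‖Y n - Y (n - 1)‖ ^ 2 := by positivity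
    simp only [d] at h1
    linarith
  simpa [(hq n).ne'] using h2

/-! ### Inverting `L` and `A` -/

theorem opL_apply (δ : ℝ) (q : Z0 → ℝ) (y : (opL δ q).domain) (n : Z0) :
    opL δ q y n = diffExpr δ q (y : l20) n :=
  rfl

theorem tendsto_inv_cofinite {q : Z0 → ℝ}
    (hq : Tendsto q (comap (fun n : Z0 => |(n : ℤ)|) atTop) atTop) :
    Tendsto (fun n => ((q n : ℂ))⁻¹) cofinite (𝓝 0) := by
  have h1 : Tendsto (fun n : Z0 => |(n : ℤ)|) cofinite atTop := by
    refine tendsto_atTop.2 fun b => ?_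
    refine ((Set.finite_Ioo (-b) b).preimage Subtype.val_injective.injOn).subset fun n hn => ?_
    exact abs_lt.1 (not_le.1 hn)
  have h2 : Tendsto q cofinite atTop := hq.comp (tendsto_iff_comap.1 h1)
  have h3 := (Complex.continuous_ofReal.tendsto 0).comp (tendsto_inv_atTop_zero.comp h2)
  simpa [Function.comp_def] using h3

/-- `L` has a compact inverse defined on the whole space. -/
theorem exists_isBoundedInverse_opL {δ : ℝ} (hδ : δ ∈ Set.Ico 0 (Real.pi / 2))
    {q : Z0 → ℝ} {c : ℝ} (hc : 0 < c) (hqc : ∀ n, c ≤ q n)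
    (hq : Tendsto q (comap (fun n : Z0 => |(n : ℤ)|) atTop) atTop) :
    ∃ Linv : l20 →L[ℂ] l20, IsBoundedInverse (opL δ q) Linv ∧ IsCompactOperator Linv := by
  have hq0 : ∀ n, (q n : ℂ) ≠ 0 := fun n => Complex.ofReal_ne_zero.2 (hc.trans_le (hqc n)).ne'
  have ha : ∀ n, ‖((q n : ℂ))⁻¹‖ ≤ c⁻¹ := fun n => by
    rw [norm_inv, Complex.norm_real]
    exact inv_anti₀ hc ((hqc n).trans (Real.le_norm_self _))
  set K : l20 →L[ℂ] l20 := diagonal (fun n => ((q n : ℂ))⁻¹) c⁻¹ ha with hKdef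
  have hKapp : ∀ y n, K y n = ((q n : ℂ))⁻¹ * y n := fun y n => rfl
  have hK : IsCompactOperator K := isCompactOperator_diagonal ha (tendsto_inv_cofinite hq)
  set S : l20 →L[ℂ] l20 := K ∘L secondDiff δ with hSdef
  have hS : IsCompactOperator S := hK.comp_clm (secondDiff δ)
  have hQ : ∀ y f : l20, y + S y = K f ↔ ∀ n, diffExpr δ q y n = f n := by
    intro y f
    have h1 : ∀ n, (y + S y) n = ((q n : ℂ))⁻¹ * diffExpr δ q y n := fun n => by
      rw [diffExpr_eq_add, mul_add, inv_mul_cancel_left₀ (hq0 n), add_comm]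
      rfl
    refine ⟨fun h n => ?_, fun h => lp.ext (funext fun n => ?_)⟩
    · have h2 := h1 n
      rw [h, hKapp] at h2
      exact (mul_left_cancel₀ (inv_ne_zero (hq0 n)) h2).symm
    · rw [h1, h n, hKapp]
  -- By the Fredholm alternative only the eigenvalue `-1` of `S` could obstruct; by `hQ` its
  -- eigenvector would lie in the kernel of the difference expression.
  have hunit : IsUnit (1 + S) := by
    rcases hS.hasEigenvalue_or_mem_resolventSet (μ := -1) (by norm_num) with he | hr
    · obtain ⟨y, hy⟩ := he.exists_hasEigenvector
      have h1 : S y = (-1 : ℂ) • y := hy.apply_eq_smul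
      have h2 : y + S y = K 0 := by rw [h1, map_zero, neg_one_smul, add_neg_cancel]
      have h3 := eq_zero_of_diffExpr_eq_zero hδ (fun n => hc.trans_le (hqc n)) (lp.memℓp y)
        fun n => (hQ y 0).1 h2 n
      exact absurd (lp.ext h3) hy.2
    · rw [spectrum.mem_resolventSet_iff] at hr
      rw [show (1 : l20 →L[ℂ] l20) + S = -(algebraMap ℂ (l20 →L[ℂ] l20) (-1) - S) by
        rw [map_neg, map_one]; abel]
      exact hr.neg
  obtain ⟨u, hu⟩ := hunit
  have hl : ∀ x, (↑u⁻¹ : l20 →L[ℂ] l20) (x + S x) = x := fun x => by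
    have := congrArg (fun f : l20 →L[ℂ] l20 => f x) u.inv_mul
    rw [hu] at this
    simpa using this
  have hr : ∀ x, (↑u⁻¹ : l20 →L[ℂ] l20) x + S ((↑u⁻¹ : l20 →L[ℂ] l20) x) = x := fun x => by
    have := congrArg (fun f : l20 →L[ℂ] l20 => f x) u.mul_inv
    rw [hu] at this
    simpa using this
  refine ⟨(↑u⁻¹ : l20 →L[ℂ] l20) ∘L K, ⟨fun y => ?_, fun f => ?_⟩, hK.clm_comp _⟩
  · change (↑u⁻¹ : l20 →L[ℂ] l20) (K (opL δ q y)) = y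
    rw [← (hQ y (opL δ q y)).2 fun n => rfl, hl]
  · have h1 := (hQ _ f).1 (hr (K f))
    have hdom : (↑u⁻¹ : l20 →L[ℂ] l20) (K f) ∈ domL q := by
      change Memℓp _ 2
      -- The solution lies in the domain because the equation gives `q y = f - T y`, with `T`
      -- bounded.
      convert (lp.memℓp f).sub (lp.memℓp (secondDiff δ ((↑u⁻¹ : l20 →L[ℂ] l20) (K f)))) using 1
      funext n
      rw [Pi.sub_apply, ← h1 n, diffExpr_eq_add, secondDiff_apply, add_sub_cancel_left]
    exact ⟨hdom, lp.ext (funext h1)⟩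

theorem isBoundedInverse_opA {δ : ℝ} {q : Z0 → ℝ} {B : l20 →L[ℂ] l20}
    (hB : IsBoundedInverse (opL δ q) B) :
    IsBoundedInverse (opA δ q) (B ∘L (opM δ : l20 →L[ℂ] l20)) := by
  refine ⟨fun y => ?_, fun f => ?_⟩
  · change B (opM δ ((opM δ).symm (opL δ q y))) = y
    rw [LinearIsometryEquiv.apply_symm_apply]
    exact hB.1 y
  · obtain ⟨h1, h2⟩ := hB.2 (opM δ f)
    refine ⟨h1, ?_⟩
    change (opM δ).symm (opL δ q ⟨B (opM δ f), h1⟩) = f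
    rw [h2, LinearIsometryEquiv.symm_apply_apply]

end DiscreteNonHermitian

theorem corollary7p2 (δ : ℝ) (hδ : δ ∈ Set.Ico 0 (Real.pi / 2))
    (q : Z0 → ℝ) (c : ℝ) (hc : 0 < c) (hqc : ∀ n, c ≤ q n)
    (hq : Tendsto q (comap (fun n : Z0 => |(n : ℤ)|) atTop) atTop) :
    (∃ Linv : l20 →L[ℂ] l20,
      IsBoundedInverse (opL δ q) Linv ∧
      IsBoundedInverse (opA δ q) (Linv ∘L (opM δ : l20 →L[ℂ] l20)) ∧
      IsCompactOperator (Linv ∘L (opM δ : l20 →L[ℂ] l20))) ∧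
    HasDiscreteSpectrum (opA δ q) := by
  obtain ⟨B, hB, hBc⟩ := exists_isBoundedInverse_opL hδ hc hqc hq
  have hA := isBoundedInverse_opA hB
  have hAc : IsCompactOperator (B ∘L (opM δ : l20 →L[ℂ] l20)) :=
    hBc.comp_clm (opM δ : l20 →L[ℂ] l20)
  exact ⟨⟨B, hB, hA, hAc⟩, hasDiscreteSpectrum_of_isCompactOperator hA hAc⟩
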